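/- Let $[3]=\{1,2,3\}$ and let $A_{123}$ be the Abelian lattice-ordered group ($\ell$-group) defined by the generators $a,a',b,c$ subjected to the relations $0\le a\le a'\le 2a$, $0\le b$, $0\le c$. Let $A_{12}=A_{21}$, $A_{13}=A_{31}$, $A_{23}=A_{32}$ be the $\ell$-subgroups of $A_{123}$ generated by $\{a,b\}$, $\{a',c\}$, $\{b,c\}$, respectively. For an Abelian $\ell$-group $G$, let $\mathrm{Id}_c\,G$ be the distributive lattice with zero of all finitely generated $\ell$-ideals (order-convex $\ell$-subgroups) of $G$, ordered by inclusion, and write $\langle x\rangle$ for the $\ell$-ideal generated by $x$. For $i\neq j$ in $[3]$, let $\boldsymbol{\alpha}_{ij}^{123}\colon \mathrm{Id}_c\,A_{ij}\to\mathrm{Id}_c\,A_{123}$ be the map that sends each $I$ to the $\ell$-ideal of $A_{123}$ generated by $I$ (that is, the map induced by the inclusion $A_{ij}\hookrightarrow A_{123}$). Put $\boldsymbol{a}_1=\langle a\rangle=\langle a'\rangle$, $\boldsymbol{a}_2=\langle b\rangle$, $\boldsymbol{a}_3=\langle c\rangle$ in $\mathrm{Id}_c\,A_{123}$. Then there is no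 family $(\boldsymbol{c}_{ij})_{i\neq j\text{ in }[3]}$ of elements of $\mathrm{Id}_c\,A_{123}$ satisfying all of the following statements: 1. each $\boldsymbol{c}_{ij}$ belongs to the range of $\boldsymbol{\alpha}_{ij}^{123}$; 2. $\boldsymbol{a}_i\le\boldsymbol{a}_j\vee\boldsymbol{c}_{ij}$ whenever $\{i,j\}$ is either $\{1,2\}$ or $\{2,3\}$; 3. $\boldsymbol{c}_{ij}\wedge\boldsymbol{c}_{ji}=0$ whenever $\{i,j\}$ is either $\{1,2\}$ or $\{2,3\}$; 4. $\boldsymbol{c}_{12}\wedge\boldsymbol{c}_{23}\le\boldsymbol{c}_{13}\le\boldsymbol{c}_{12}\vee\boldsymbol{c}_{23}$. -/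

import Mathlib

/-! Abelian ℓ-groups are types `G` with `[AddCommGroup G] [Lattice G] [IsOrderedAddMonoid G]`. -/

namespace LGrp

universe u v

/-! ### ℓ-homomorphisms -/

/-- Homomorphisms of Abelian ℓ-groups. -/
structure Hom (G : Type u) (H : Type v) [AddCommGroup G] [Lattice G] [AddCommGroup H] [Lattice H]
    extends G →+ H where
  map_sup' : ∀ x y : G, toFun (x ⊔ y) = toFun x ⊔ toFun y
  map_inf' : ∀ x y : G, toFun (x ⊓ y) = toFun x ⊓ toFun y

/-! ### ℓ-subgroups -/

/-- ℓ-subgroups: subgroups that are also sublattices. -/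
structure Sub (G : Type u) [AddCommGroup G] [Lattice G] extends AddSubgroup G where
  sup_mem' : ∀ x y : G, x ∈ carrier → y ∈ carrier → x ⊔ y ∈ carrier
  inf_mem' : ∀ x y : G, x ∈ carrier → y ∈ carrier → x ⊓ y ∈ carrier

namespace Sub

variable {G : Type u} [AddCommGroup G] [Lattice G]

instance : SetLike (Sub G) G where
  coe H := H.carrier
  coe_injective := by
    rintro ⟨H, _, _⟩ ⟨K, _, _⟩ h
    have : H = K := SetLike.coe_injective h
    subst this
    rfl

instance : AddSubgroupClass (Sub G) G where
  add_mem {H} := H.add_mem'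
  zero_mem H := H.zero_mem'
  neg_mem {H} := H.neg_mem'

instance (H : Sub G) : Lattice H :=
  Subtype.lattice (fun {x y} hx hy => H.sup_mem' x y hx hy)
    (fun {x y} hx hy => H.inf_mem' x y hx hy)

instance [IsOrderedAddMonoid G] (H : Sub G) : IsOrderedAddMonoid H where
  add_le_add_left x y h z := add_le_add_left (show (x : G) ≤ y from h) (z : G)

/-- The ℓ-subgroup generated by a set. -/
def closure (s : Set G) : Sub G where
  carrier := {x | ∀ H : Sub G, s ⊆ H → x ∈ H}
  zero_mem' := fun H _ => zero_mem H
  add_mem' := fun hx hy H hs => add_mem (hx H hs) (hy H hs)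
  neg_mem' := fun hx H hs => neg_mem (hx H hs)
  sup_mem' := fun _ _ hx hy H hs => H.sup_mem' _ _ (hx H hs) (hy H hs)
  inf_mem' := fun _ _ hx hy H hs => H.inf_mem' _ _ (hx H hs) (hy H hs)

/-- The inclusion map of an ℓ-subgroup. -/
def incl (H : Sub G) : Hom H G where
  toFun x := x
  map_zero' := rfl
  map_add' _ _ := rfl
  map_sup' _ _ := rfl
  map_inf' _ _ := rfl

end Sub

/-! ### ℓ-ideals -/

/-- ℓ-ideals of an Abelian ℓ-group: order-convex ℓ-subgroups. -/
structure LIdeal (G : Type u) [AddCommGroup G] [Lattice G] extends Sub G where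
  convex' : ∀ x y z : G, x ∈ carrier → y ∈ carrier → x ≤ z → z ≤ y → z ∈ carrier

namespace LIdeal

variable {G : Type u} [AddCommGroup G] [Lattice G]

instance : SetLike (LIdeal G) G where
  coe I := I.carrier
  coe_injective := by
    rintro ⟨H, _⟩ ⟨K, _⟩ h
    have : H = K := SetLike.coe_injective h
    subst this
    rfl

instance : AddSubgroupClass (LIdeal G) G where
  add_mem {I} := I.add_mem'
  zero_mem I := I.zero_mem'
  neg_mem {I} := I.neg_mem'

theorem sup_mem (I : LIdeal G) {x y : G} (hx : x ∈ I) (hy : y ∈ I) : x ⊔ y ∈ I :=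
  I.sup_mem' x y hx hy

theorem inf_mem (I : LIdeal G) {x y : G} (hx : x ∈ I) (hy : y ∈ I) : x ⊓ y ∈ I :=
  I.inf_mem' x y hx hy

theorem convex (I : LIdeal G) {x y z : G} (hx : x ∈ I) (hy : y ∈ I) (hxz : x ≤ z) (hzy : z ≤ y) :
    z ∈ I :=
  I.convex' x y z hx hy hxz hzy

/-- ℓ-ideals are ordered by inclusion. -/
instance : PartialOrder (LIdeal G) := PartialOrder.lift (fun I => (I : Set G)) SetLike.coe_injective

theorem le_def {I J : LIdeal G} : I ≤ J ↔ ∀ x ∈ I, x ∈ J := Iff.rfl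

instance : InfSet (LIdeal G) where
  sInf S :=
    { carrier := {x | ∀ I ∈ S, x ∈ I}
      zero_mem' := fun I _ => zero_mem I
      add_mem' := fun hx hy I hI => add_mem (hx I hI) (hy I hI)
      neg_mem' := fun hx I hI => neg_mem (hx I hI)
      sup_mem' := fun _ _ hx hy I hI => I.sup_mem (hx I hI) (hy I hI)
      inf_mem' := fun _ _ hx hy I hI => I.inf_mem (hx I hI) (hy I hI)
      convex' := fun _ _ _ hx hy h₁ h₂ I hI => I.convex (hx I hI) (hy I hI) h₁ h₂ }

/-- The complete lattice of all ℓ-ideals. -/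
instance : CompleteLattice (LIdeal G) :=
  completeLatticeOfInf (LIdeal G) fun _ =>
    ⟨fun _ hI _ hx => hx _ hI, fun _ hJ _ hx _ hI => hJ hI hx⟩

/-- The ℓ-ideal generated by a set. -/
def span (s : Set G) : LIdeal G := sInf {I | s ⊆ I}

theorem subset_span (s : Set G) : s ⊆ span s := fun _ hx _ hI => hI hx

theorem span_le {s : Set G} {I : LIdeal G} : span s ≤ I ↔ s ⊆ I :=
  ⟨fun h _ hx => h (subset_span s hx), fun h _ hx => hx I h⟩

theorem span_union (s t : Set G) : span (s ∪ t) = span s ⊔ span t := by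
  apply le_antisymm
  · rw [span_le]
    rintro x (hx | hx)
    · exact (le_sup_left : span s ≤ span s ⊔ span t) (subset_span s hx)
    · exact (le_sup_right : span t ≤ span s ⊔ span t) (subset_span t hx)
  · exact sup_le (span_le.2 fun _ hx => subset_span _ (Or.inl hx))
      (span_le.2 fun _ hx => subset_span _ (Or.inr hx))

theorem span_empty : span (∅ : Set G) = ⊥ := le_bot_iff.1 (span_le.2 (Set.empty_subset _))

theorem mem_inf {I J : LIdeal G} {x : G} : x ∈ I ⊓ J ↔ x ∈ I ∧ x ∈ J := by
  constructor
  · exact fun h => ⟨(inf_le_left : I ⊓ J ≤ I) h, (inf_le_right : I ⊓ J ≤ J) h⟩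
  · rintro ⟨hI, hJ⟩ K hK
    rcases hK with rfl | rfl
    · exact hI
    · exact hJ

theorem abs_mem (I : LIdeal G) {x : G} (hx : x ∈ I) : |x| ∈ I := I.sup_mem hx (neg_mem hx)

variable [IsOrderedAddMonoid G]

theorem mem_of_abs_le (I : LIdeal G) {x y : G} (hx : x ∈ I) (h : |y| ≤ |x|) : y ∈ I := by
  have hx' := I.abs_mem hx
  exact I.convex (neg_mem hx') hx' (neg_le.1 ((neg_le_abs y).trans h)) ((le_abs_self y).trans h)

/-- `⟨x⟩ = {y | ∃ n, |y| ≤ n |x|}`, shown below to be the ℓ-ideal generated by `x`. -/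
def principal (x : G) : LIdeal G where
  carrier := {y | ∃ n : ℕ, |y| ≤ n • |x|}
  zero_mem' := ⟨0, by simp⟩
  add_mem' := by
    rintro y z ⟨n, hn⟩ ⟨m, hm⟩
    exact ⟨n + m, (abs_add_le y z).trans (by rw [add_nsmul]; exact add_le_add hn hm)⟩
  neg_mem' := by
    rintro y ⟨n, hn⟩
    exact ⟨n, by rwa [abs_neg]⟩
  sup_mem' := by
    rintro y z ⟨n, hn⟩ ⟨m, hm⟩
    refine ⟨n + m, ?_⟩
    have h := add_le_add hn hm
    rw [← add_nsmul] at h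
    refine le_trans (abs_le'.2 ⟨sup_le ?_ ?_, ?_⟩) h
    · exact (le_abs_self y).trans (le_add_of_nonneg_right (abs_nonneg z))
    · exact (le_abs_self z).trans (le_add_of_nonneg_left (abs_nonneg y))
    · rw [neg_sup]
      exact inf_le_left.trans ((neg_le_abs y).trans (le_add_of_nonneg_right (abs_nonneg z)))
  inf_mem' := by
    rintro y z ⟨n, hn⟩ ⟨m, hm⟩
    refine ⟨n + m, ?_⟩
    have h := add_le_add hn hm
    rw [← add_nsmul] at h
    refine le_trans (abs_le'.2 ⟨?_, ?_⟩) h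
    · exact inf_le_left.trans ((le_abs_self y).trans (le_add_of_nonneg_right (abs_nonneg z)))
    · rw [neg_inf]
      exact sup_le ((neg_le_abs y).trans (le_add_of_nonneg_right (abs_nonneg z)))
        ((neg_le_abs z).trans (le_add_of_nonneg_left (abs_nonneg y)))
  convex' := by
    rintro y z w ⟨n, hn⟩ ⟨m, hm⟩ hyw hwz
    refine ⟨n + m, ?_⟩
    have h := add_le_add hn hm
    rw [← add_nsmul] at h
    refine le_trans (abs_le'.2 ⟨?_, ?_⟩) h
    · exact hwz.trans ((le_abs_self z).trans (le_add_of_nonneg_left (abs_nonneg y)))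
    · exact (neg_le_neg hyw).trans
        ((neg_le_abs y).trans (le_add_of_nonneg_right (abs_nonneg z)))

theorem mem_principal {x y : G} : y ∈ principal x ↔ ∃ n : ℕ, |y| ≤ n • |x| := Iff.rfl

theorem span_singleton (x : G) : span {x} = principal x := by
  apply le_antisymm
  · rw [span_le]
    rintro _ rfl
    exact ⟨1, by simp⟩
  · rintro y ⟨n, hn⟩
    refine mem_of_abs_le (x := n • |x|) _ (nsmul_mem (abs_mem _ (subset_span {x} rfl)) n) ?_
    exact hn.trans (le_abs_self _)

theorem principal_sup (x y : G) : principal x ⊔ principal y = principal (|x| + |y|) := by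
  apply le_antisymm
  · apply sup_le <;> rw [← span_singleton, span_le, Set.singleton_subset_iff] <;>
      refine ⟨1, ?_⟩ <;> rw [one_nsmul] <;> refine le_trans ?_ (le_abs_self _)
    · exact le_add_of_nonneg_right (abs_nonneg y)
    · exact le_add_of_nonneg_left (abs_nonneg x)
  · rw [← span_singleton (_ + _), span_le, Set.singleton_subset_iff]
    apply add_mem
    · exact abs_mem _ ((le_sup_left : principal x ≤ _) ⟨1, by simp⟩)
    · exact abs_mem _ ((le_sup_right : principal y ≤ _) ⟨1, by simp⟩)

theorem exists_principal_of_finite {s : Set G} (hs : s.Finite) : ∃ x, span s = principal x := by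
  induction s, hs using Set.Finite.induction_on with
  | empty =>
    refine ⟨0, ?_⟩
    rw [← span_singleton, span_empty]
    exact le_antisymm bot_le (span_le.2 (Set.singleton_subset_iff.2 (zero_mem _)))
  | @insert y s _ _ ih =>
    obtain ⟨x, hx⟩ := ih
    exact ⟨|y| + |x|, by rw [Set.insert_eq, span_union, hx, span_singleton, principal_sup]⟩

theorem inf_add_le {x y z : G} (hx : 0 ≤ x) (hy : 0 ≤ y) (hz : 0 ≤ z) :
    x ⊓ (y + z) ≤ x ⊓ y + x ⊓ z := by
  rw [add_inf, inf_add, inf_add]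
  refine le_inf (le_inf ?_ ?_) (le_inf ?_ ?_)
  · exact inf_le_left.trans (le_add_of_nonneg_left hx)
  · exact inf_le_left.trans (le_add_of_nonneg_left hy)
  · exact inf_le_left.trans (le_add_of_nonneg_right hz)
  · exact inf_le_right

theorem inf_nsmul_le {x y : G} (hx : 0 ≤ x) (hy : 0 ≤ y) (n : ℕ) : x ⊓ n • y ≤ n • (x ⊓ y) := by
  induction n with
  | zero => simp
  | succ n ih =>
    rw [succ_nsmul, succ_nsmul]
    exact (inf_add_le hx (nsmul_nonneg hy n) hy).trans (add_le_add ih le_rfl)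

theorem principal_inf (x y : G) : principal x ⊓ principal y = principal (|x| ⊓ |y|) := by
  have h0 : 0 ≤ |x| ⊓ |y| := le_inf (abs_nonneg x) (abs_nonneg y)
  apply le_antisymm
  · intro z hz
    obtain ⟨⟨n, hn⟩, ⟨m, hm⟩⟩ := mem_inf.1 hz
    refine ⟨n * m, ?_⟩
    rw [abs_of_nonneg h0]
    calc |z| ≤ n • |x| ⊓ m • |y| := le_inf hn hm
      _ ≤ m • (n • |x| ⊓ |y|) := inf_nsmul_le (nsmul_nonneg (abs_nonneg x) n) (abs_nonneg y) m
      _ ≤ m • (n • (|x| ⊓ |y|)) := by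
        apply nsmul_le_nsmul_right
        rw [inf_comm, inf_comm |x|]
        exact inf_nsmul_le (abs_nonneg y) (abs_nonneg x) n
      _ = (n * m) • (|x| ⊓ |y|) := by rw [mul_nsmul]
  · apply le_inf <;> rw [← span_singleton, span_le, Set.singleton_subset_iff] <;>
      refine ⟨1, ?_⟩ <;> rw [one_nsmul, abs_of_nonneg h0]
    · exact inf_le_left
    · exact inf_le_right

end LIdeal

/-! ### The functor `Idc` -/

/-- The set of all finitely generated ℓ-ideals of `G`, ordered by inclusion. -/
def Idc (G : Type u) [AddCommGroup G] [Lattice G] : Type u :=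
  {I : LIdeal G // ∃ s : Set G, s.Finite ∧ I = LIdeal.span s}

namespace Idc

section Order

variable {G : Type u} [AddCommGroup G] [Lattice G] [IsOrderedAddMonoid G]

/-- `Idc G` as a sublattice of the lattice of all ℓ-ideals of `G`. -/
instance : Lattice (Idc G) :=
  Subtype.lattice
    (fun {I J} hI hJ => by
      obtain ⟨s, hs, rfl⟩ := hI
      obtain ⟨t, ht, rfl⟩ := hJ
      exact ⟨s ∪ t, hs.union ht, (LIdeal.span_union s t).symm⟩)
    (fun {I J} hI hJ => by
      obtain ⟨s, hs, rfl⟩ := hI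
      obtain ⟨t, ht, rfl⟩ := hJ
      obtain ⟨x, hx⟩ := LIdeal.exists_principal_of_finite hs
      obtain ⟨y, hy⟩ := LIdeal.exists_principal_of_finite ht
      exact ⟨{|x| ⊓ |y|}, Set.finite_singleton _, by
        rw [hx, hy, LIdeal.principal_inf, LIdeal.span_singleton]⟩)

/-- The zero of `Idc G` is the zero ideal. -/
instance : OrderBot (Idc G) :=
  Subtype.orderBot ⟨∅, Set.finite_empty, LIdeal.span_empty.symm⟩

end Order

/-- The ℓ-ideal generated by an element, as an element of `Idc G`. -/
def gen {G : Type u} [AddCommGroup G] [Lattice G] (x : G) : Idc G :=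
  ⟨LIdeal.span {x}, {x}, Set.finite_singleton x, rfl⟩

/-- The preimage of an ℓ-ideal under an ℓ-homomorphism. -/
def comap {G : Type u} {H : Type v} [AddCommGroup G] [Lattice G]
    [AddCommGroup H] [Lattice H] (f : Hom G H) (J : LIdeal H) : LIdeal G where
  toAddSubgroup := J.toAddSubgroup.comap f.toAddMonoidHom
  sup_mem' x y hx hy := by
    change f.toFun (x ⊔ y) ∈ J
    rw [f.map_sup']
    exact J.sup_mem hx hy
  inf_mem' x y hx hy := by
    change f.toFun (x ⊓ y) ∈ J
    rw [f.map_inf']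
    exact J.inf_mem hx hy
  convex' x y z hx hy hxz hzy := by
    refine J.convex (z := f.toFun z) hx hy ?_ ?_
    · exact sup_eq_right.1 ((f.map_sup' x z).symm.trans (congrArg f.toFun (sup_eq_right.2 hxz)))
    · exact sup_eq_right.1 ((f.map_sup' z y).symm.trans (congrArg f.toFun (sup_eq_right.2 hzy)))

/-- `Idc f` sends a finitely generated ℓ-ideal `I` to the ℓ-ideal generated by `f(I)`. -/
def map {G : Type u} {H : Type v} [AddCommGroup G] [Lattice G]
    [AddCommGroup H] [Lattice H] (f : Hom G H) (I : Idc G) : Idc H :=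
  ⟨LIdeal.span (f.toFun '' (I.1 : Set G)), by
    obtain ⟨I, s, hs, rfl⟩ := I
    refine ⟨f.toFun '' s, hs.image _, le_antisymm (LIdeal.span_le.2 ?_) (LIdeal.span_le.2 ?_)⟩
    · rintro _ ⟨x, hx, rfl⟩
      have h : LIdeal.span s ≤ comap f (LIdeal.span (f.toFun '' s)) :=
        LIdeal.span_le.2 fun y hy => LIdeal.subset_span _ ⟨y, hy, rfl⟩
      exact h hx
    · rintro _ ⟨x, hx, rfl⟩
      exact LIdeal.subset_span _ ⟨x, LIdeal.subset_span _ hx, rfl⟩⟩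

end Idc

/-! ### Abelian ℓ-groups given by generators and relations -/

/-- Terms in the similarity type `(0, +, -, ⊔, ⊓)`, with variables in `X`. -/
inductive Term (X : Type u) : Type u
  | var : X → Term X
  | zero : Term X
  | add : Term X → Term X → Term X
  | neg : Term X → Term X
  | sup : Term X → Term X → Term X
  | inf : Term X → Term X → Term X

/-- The congruence on terms generated by the axioms of Abelian ℓ-groups together with the
inequalities `s ≤ t` (that is, `s ⊔ t = t`) for `R s t`. -/
inductive Cong {X : Type u} (R : Term X → Term X → Prop) : Term X → Term X → Prop
  | refl (s) : Cong R s s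
  | symm {s t} : Cong R s t → Cong R t s
  | trans {r s t} : Cong R r s → Cong R s t → Cong R r t
  | add {s s' t t'} : Cong R s s' → Cong R t t' → Cong R (.add s t) (.add s' t')
  | neg {s s'} : Cong R s s' → Cong R (.neg s) (.neg s')
  | sup {s s' t t'} : Cong R s s' → Cong R t t' → Cong R (.sup s t) (.sup s' t')
  | inf {s s' t t'} : Cong R s s' → Cong R t t' → Cong R (.inf s t) (.inf s' t')
  | add_assoc (r s t) : Cong R (.add (.add r s) t) (.add r (.add s t))
  | add_comm (s t) : Cong R (.add s t) (.add t s)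
  | zero_add (s) : Cong R (.add .zero s) s
  | neg_add (s) : Cong R (.add (.neg s) s) .zero
  | sup_assoc (r s t) : Cong R (.sup (.sup r s) t) (.sup r (.sup s t))
  | sup_comm (s t) : Cong R (.sup s t) (.sup t s)
  | inf_assoc (r s t) : Cong R (.inf (.inf r s) t) (.inf r (.inf s t))
  | inf_comm (s t) : Cong R (.inf s t) (.inf t s)
  | sup_inf_self (s t) : Cong R (.sup s (.inf s t)) s
  | inf_sup_self (s t) : Cong R (.inf s (.sup s t)) s
  | add_sup (r s t) : Cong R (.add r (.sup s t)) (.sup (.add r s) (.add r t))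
  | rel {s t} : R s t → Cong R (.sup s t) t

/-- The congruence as a setoid. -/
def congSetoid {X : Type u} (R : Term X → Term X → Prop) : Setoid (Term X) where
  r := Cong R
  iseqv := ⟨Cong.refl, Cong.symm, Cong.trans⟩

/-- The Abelian ℓ-group defined by the set `X` of generators, subjected to the relations `s ≤ t`
for `R s t`. -/
def Presented {X : Type u} (R : Term X → Term X → Prop) : Type u := Quotient (congSetoid R)

namespace Presented

variable {X : Type u} {R : Term X → Term X → Prop}

/-- The element represented by a term. -/
def mk (R : Term X → Term X → Prop) (t : Term X) : Presented R := Quotient.mk (congSetoid R) t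

theorem mk_eq {s t : Term X} (h : Cong R s t) : mk R s = mk R t := Quotient.sound h

theorem ind {p : Presented R → Prop} (h : ∀ t, p (mk R t)) (x) : p x := Quotient.ind h x

instance : Zero (Presented R) := ⟨mk R .zero⟩

instance : Add (Presented R) := ⟨Quotient.map₂ Term.add fun _ _ h _ _ h' => Cong.add h h'⟩

instance : Neg (Presented R) := ⟨Quotient.map Term.neg fun _ _ h => Cong.neg h⟩

/-- The join operation. -/
abbrev maxOp : Max (Presented R) :=
  ⟨Quotient.map₂ Term.sup fun _ _ h _ _ h' => Cong.sup h h'⟩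

/-- The meet operation. -/
abbrev minOp : Min (Presented R) :=
  ⟨Quotient.map₂ Term.inf fun _ _ h _ _ h' => Cong.inf h h'⟩

protected theorem add_comm' (x y : Presented R) : x + y = y + x := by
  induction x using ind with | h s
  induction y using ind with | h t
  exact mk_eq (Cong.add_comm s t)

protected theorem zero_add' (x : Presented R) : 0 + x = x := by
  induction x using ind with | h s
  exact mk_eq (Cong.zero_add s)

instance : AddCommGroup (Presented R) where
  add_assoc x y z := by
    induction x using ind with | h r
    induction y using ind with | h s
    induction z using ind with | h t
    exact mk_eq (Cong.add_assoc r s t)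
  zero_add := Presented.zero_add'
  add_zero x := by rw [Presented.add_comm', Presented.zero_add']
  add_comm := Presented.add_comm'
  neg_add_cancel x := by
    induction x using ind with | h s
    exact mk_eq (Cong.neg_add s)
  nsmul := nsmulRec
  zsmul := zsmulRec

/-- The lattice structure induced by the operations; thus `x ≤ y` if and only if `x ⊔ y = y`. -/
instance : Lattice (Presented R) :=
  @Lattice.mk' _ maxOp minOp
    (fun x y => by
      induction x using ind with | h s
      induction y using ind with | h t
      exact mk_eq (Cong.sup_comm s t))
    (fun x y z => by
      induction x using ind with | h r
      induction y using ind with | h s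
      induction z using ind with | h t
      exact mk_eq (Cong.sup_assoc r s t))
    (fun x y => by
      induction x using ind with | h s
      induction y using ind with | h t
      exact mk_eq (Cong.inf_comm s t))
    (fun x y z => by
      induction x using ind with | h r
      induction y using ind with | h s
      induction z using ind with | h t
      exact mk_eq (Cong.inf_assoc r s t))
    (fun x y => by
      induction x using ind with | h s
      induction y using ind with | h t
      exact mk_eq (Cong.sup_inf_self s t))
    (fun x y => by
      induction x using ind with | h s
      induction y using ind with | h t
      exact mk_eq (Cong.inf_sup_self s t))

protected theorem add_sup' (x y z : Presented R) : x + (y ⊔ z) = (x + y) ⊔ (x + z) := by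
  induction x using ind with | h r
  induction y using ind with | h s
  induction z using ind with | h t
  exact mk_eq (Cong.add_sup r s t)

instance : IsOrderedAddMonoid (Presented R) where
  add_le_add_left x y h z := by
    rw [Presented.add_comm' x, Presented.add_comm' y, ← sup_eq_right, ← Presented.add_sup',
      sup_eq_right.2 h]

theorem mk_le {s t : Term X} (h : R s t) : mk R s ≤ mk R t := sup_eq_right.1 (mk_eq (Cong.rel h))

end Presented

/-! ### The ℓ-group `A₁₂₃` and its ℓ-subgroups -/

/-- The generators `a`, `a'`, `b`, `c`. -/
inductive Gen
  | a | a' | b | c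

/-- The relations `0 ≤ a ≤ a' ≤ 2a`, `0 ≤ b`, `0 ≤ c`. -/
inductive Rel : Term Gen → Term Gen → Prop
  | zero_le_a : Rel .zero (.var .a)
  | a_le_a' : Rel (.var .a) (.var .a')
  | a'_le_two_a : Rel (.var .a') (.add (.var .a) (.var .a))
  | zero_le_b : Rel .zero (.var .b)
  | zero_le_c : Rel .zero (.var .c)

/-- The Abelian ℓ-group with generators `a, a', b, c` and relations
`0 ≤ a ≤ a' ≤ 2a`, `0 ≤ b`, `0 ≤ c`. -/
abbrev A123 : Type := Presented Rel

/-- The canonical generators of `A₁₂₃`. -/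
def A123.gen (x : Gen) : A123 := Presented.mk Rel (.var x)

/-- The canonical generators of the vertex `A_p`, as elements of `A₁₂₃`, for `p ⊆ [3]`. Here and
below the elements `0, 1, 2` of `Fin 3` stand for the elements `1, 2, 3` of `[3]`. -/
def vertexGens (p : Finset (Fin 3)) : Set A123 :=
  if p = {0, 1} then {A123.gen .a, A123.gen .b}
  else if p = {0, 2} then {A123.gen .a', A123.gen .c}
  else if p = {1, 2} then {A123.gen .b, A123.gen .c}
  else if p = {0} then {A123.gen .a}
  else if p = {1} then {A123.gen .b}
  else if p = {2} then {A123.gen .c}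
  else if p = ∅ then ∅
  else {A123.gen .a, A123.gen .a', A123.gen .b, A123.gen .c}

/-- The vertex `A_p` of the diagram, as an ℓ-subgroup of `A₁₂₃`. -/
def vertex (p : Finset (Fin 3)) : Sub A123 := Sub.closure (vertexGens p)

/-- The map `Idc A_{ij} → Idc A₁₂₃` of the diagram, induced by the inclusion of `A_{ij}` in `A₁₂₃`;
only used for `i ≠ j`. -/
def alpha (i j : Fin 3) : Idc (vertex {i, j}) → Idc A123 := Idc.map (vertex {i, j}).incl

/-- The elements `⟨a⟩`, `⟨b⟩`, `⟨c⟩` of `Idc A₁₂₃`. -/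
def elt : Fin 3 → Idc A123 :=
  ![Idc.gen (A123.gen .a), Idc.gen (A123.gen .b), Idc.gen (A123.gen .c)]

/-- The ℓ-ideals of `A₁₂₃` generated by `a` and by `a'` coincide. -/
theorem gen_a_eq_gen_a' : Idc.gen (A123.gen .a) = Idc.gen (A123.gen .a') := by
  have h0 : 0 ≤ A123.gen .a := Presented.mk_le Rel.zero_le_a
  have h1 : A123.gen .a ≤ A123.gen .a' := Presented.mk_le Rel.a_le_a'
  have h2 : A123.gen .a' ≤ A123.gen .a + A123.gen .a := Presented.mk_le Rel.a'_le_two_a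
  have h3 := h0.trans h1
  refine Subtype.ext (le_antisymm ?_ ?_)
  · refine LIdeal.span_le.2 (Set.singleton_subset_iff.2 ?_)
    exact LIdeal.convex _ (zero_mem _) (LIdeal.subset_span _ rfl) h0 h1
  · refine LIdeal.span_le.2 (Set.singleton_subset_iff.2 ?_)
    have h := LIdeal.subset_span {A123.gen .a} rfl
    exact LIdeal.convex _ (zero_mem _) (add_mem h h) h3 h2

end LGrp

namespace LGrp

universe u

/-! Every point `v` of the cone `0 ≤ a ≤ a' ≤ 2a`, `0 ≤ b`, `0 ≤ c` in ℝ⁴ defines an ℓ-homomorphism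
from `A123` to ℝ. Its kernel `vanishing` is prime because ℝ is totally ordered, so at each point
joins and meets in `Idc A123` become "or" and "and" of being nonzero. Finitely generated ideals are
principal, hence each `c i j` is the ideal of one continuous, positively homogeneous function, and
the range condition makes its zero set depend only on the two coordinates generating `A_ij`
(`map_incl_le_vanishing`).

By `exists_last_zero` there are a largest ratio `r = a/b` at which `c₁₂` vanishes and a largest
ratio `q = b/c` at which `c₂₃` vanishes. At a point with exactly these ratios `c₁₃ ≤ c₁₂ ∨ c₂₃`
makes `c₁₃` vanish. Since `c₁₃` sees `a'` and `c` only, the slack `a ≤ a' ≤ 2a` allows `a` and `b`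
to grow, with `a'` and `c` fixed, until both ratios exceed `r` and `q`. There `c₁₃` still vanishes
while `c₁₂` and `c₂₃` do not, against `c₁₂ ∧ c₂₃ ≤ c₁₃`. -/

theorem LIdeal.mem_bot {G : Type u} [AddCommGroup G] [Lattice G]
    [IsOrderedAddMonoid G] {x : G} : x ∈ (⊥ : LIdeal G) ↔ x = 0 := by
  constructor
  · intro h
    have h' : x ∈ LIdeal.principal (0 : G) := (bot_le : ⊥ ≤ LIdeal.principal (0 : G)) h
    obtain ⟨n, hn⟩ := LIdeal.mem_principal.1 h'
    rw [abs_zero, nsmul_zero] at hn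
    exact le_antisymm ((le_abs_self x).trans hn) (neg_nonpos.1 ((neg_le_abs x).trans hn))
  · rintro rfl
    exact zero_mem _

/-! ### Real valuations of terms -/

/-- The value of a term at a real valuation of its variables. -/
def Term.eval {X : Type u} (v : X → ℝ) : Term X → ℝ
  | .var x => v x
  | .zero => 0
  | .add s t => s.eval v + t.eval v
  | .neg s => -s.eval v
  | .sup s t => s.eval v ⊔ t.eval v
  | .inf s t => s.eval v ⊓ t.eval v

theorem Term.continuous_eval {X : Type u} (t : Term X) :
    Continuous fun v : X → ℝ => t.eval v := by
  induction t with
  | var x => exact continuous_apply x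
  | zero => exact continuous_const
  | add s t hs ht => exact hs.add ht
  | neg s hs => exact hs.neg
  | sup s t hs ht => exact hs.sup ht
  | inf s t hs ht => exact hs.inf ht

theorem Term.eval_smul {X : Type u} (t : Term X) {k : ℝ} (hk : 0 ≤ k) (v : X → ℝ) :
    t.eval (k • v) = k * t.eval v := by
  induction t with
  | var x => rfl
  | zero => simp [eval]
  | add s t hs ht => simp only [eval, hs, ht, mul_add]
  | neg s hs => simp only [eval, hs, mul_neg]
  | sup s t hs ht => simp only [eval, hs, ht, mul_max_of_nonneg _ _ hk]
  | inf s t hs ht => simp only [eval, hs, ht, mul_min_of_nonneg _ _ hk]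

/-- A real valuation satisfies the relations `R`. -/
def Satisfies {X : Type u} (R : Term X → Term X → Prop) (v : X → ℝ) : Prop :=
  ∀ s t, R s t → s.eval v ≤ t.eval v

/-- Only this soundness is needed: the argument uses real points to refute inequalities between
ideals, never to establish them. -/
theorem Cong.eval_eq {X : Type u} {R : Term X → Term X → Prop} {v : X → ℝ} (hv : Satisfies R v)
    {s t : Term X} (h : Cong R s t) : s.eval v = t.eval v := by
  induction h with
  | refl s => rfl
  | symm _ h => exact h.symm
  | trans _ _ h h' => exact h.trans h'
  | add _ _ h h' => simp only [Term.eval, h, h']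
  | neg _ h => simp only [Term.eval, h]
  | sup _ _ h h' => simp only [Term.eval, h, h']
  | inf _ _ h h' => simp only [Term.eval, h, h']
  | add_assoc r s t => exact _root_.add_assoc _ _ _
  | add_comm s t => exact _root_.add_comm _ _
  | zero_add s => exact _root_.zero_add _
  | neg_add s => exact neg_add_cancel _
  | sup_assoc r s t => exact _root_.sup_assoc _ _ _
  | sup_comm s t => exact _root_.sup_comm _ _
  | inf_assoc r s t => exact _root_.inf_assoc _ _ _
  | inf_comm s t => exact _root_.inf_comm _ _
  | sup_inf_self s t => exact _root_.sup_inf_self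
  | inf_sup_self s t => exact _root_.inf_sup_self
  | add_sup r s t => exact _root_.add_sup _ _ _
  | rel h => exact sup_eq_right.2 (hv _ _ h)

/-! ### Points of the cone as prime ℓ-ideals -/

namespace Presented

variable {X : Type u} {R : Term X → Term X → Prop}

/-- Evaluation at a valuation satisfying the relations, as an ℓ-homomorphism. -/
def evalHom {v : X → ℝ} (hv : Satisfies R v) : Hom (Presented R) ℝ where
  toFun := Quotient.lift (Term.eval v) fun _ _ h => Cong.eval_eq hv h
  map_zero' := rfl
  map_add' x y := by
    induction x using ind with | h s
    induction y using ind with | h t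
    rfl
  map_sup' x y := by
    induction x using ind with | h s
    induction y using ind with | h t
    rfl
  map_inf' x y := by
    induction x using ind with | h s
    induction y using ind with | h t
    rfl

/-- The ℓ-ideal of all elements vanishing at a valuation satisfying the relations. -/
def vanishing {v : X → ℝ} (hv : Satisfies R v) : LIdeal (Presented R) :=
  Idc.comap (evalHom hv) ⊥

theorem mem_vanishing {v : X → ℝ} {hv : Satisfies R v} {x : Presented R} :
    x ∈ vanishing hv ↔ (evalHom hv).toFun x = 0 :=
  LIdeal.mem_bot (x := (evalHom hv).toFun x)

theorem principal_le_vanishing {v : X → ℝ} {hv : Satisfies R v} {t : Term X} :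
    LIdeal.principal (mk R t) ≤ vanishing hv ↔ t.eval v = 0 := by
  rw [← LIdeal.span_singleton, LIdeal.span_le, Set.singleton_subset_iff]
  exact mem_vanishing

theorem exists_principal (I : Idc (Presented R)) :
    ∃ t : Term X, I.1 = LIdeal.principal (mk R t) := by
  obtain ⟨I, s, hs, rfl⟩ := I
  obtain ⟨x, hx⟩ := LIdeal.exists_principal_of_finite hs
  induction x using ind with | h t
  exact ⟨t, hx⟩

/-- The equalizer of two ℓ-homomorphisms is an ℓ-subgroup. -/
theorem eval_eq_of_mem_closure {s : Set (Presented R)} {v w : X → ℝ} (hv : Satisfies R v)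
    (hw : Satisfies R w) (h : ∀ x ∈ s, (evalHom hv).toFun x = (evalHom hw).toFun x)
    {x : Presented R} (hx : x ∈ Sub.closure s) : (evalHom hv).toFun x = (evalHom hw).toFun x := by
  let H : Sub (Presented R) :=
    { carrier := {x | (evalHom hv).toFun x = (evalHom hw).toFun x}
      zero_mem' := rfl
      add_mem' := fun {x y} hx hy => by
        have h₁ := (evalHom hv).map_add' x y
        have h₂ := (evalHom hw).map_add' x y
        simp only [Set.mem_ofPred_eq] at hx hy ⊢
        rw [hx, hy] at h₁
        exact h₁.trans h₂.symm
      neg_mem' := fun {x} hx => by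
        have h₁ := map_neg (evalHom hv).toAddMonoidHom x
        have h₂ := map_neg (evalHom hw).toAddMonoidHom x
        exact h₁.trans ((congrArg Neg.neg hx).trans h₂.symm)
      sup_mem' := fun x y hx hy => by
        simp only [Set.mem_ofPred_eq] at hx hy ⊢
        rw [Hom.map_sup', Hom.map_sup', hx, hy]
      inf_mem' := fun x y hx hy => by
        simp only [Set.mem_ofPred_eq] at hx hy ⊢
        rw [Hom.map_inf', Hom.map_inf', hx, hy] }
  exact hx H h

/-- This is how membership in the range of `alpha` is used: whether such an ideal vanishes at a
point is decided by the values of the generators in `s` there. -/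
theorem map_incl_le_vanishing {s : Set (Presented R)} {v w : X → ℝ} (hv : Satisfies R v)
    (hw : Satisfies R w) (h : ∀ x ∈ s, (evalHom hv).toFun x = (evalHom hw).toFun x)
    (J : Idc (Sub.closure s)) (hJ : (Idc.map (Sub.closure s).incl J).1 ≤ vanishing hv) :
    (Idc.map (Sub.closure s).incl J).1 ≤ vanishing hw := by
  refine LIdeal.span_le.2 ?_
  rintro _ ⟨x, hx, rfl⟩
  refine mem_vanishing.2 ((eval_eq_of_mem_closure hv hw h x.2).symm.trans ?_)
  exact mem_vanishing.1 (hJ (LIdeal.subset_span _ ⟨x, hx, rfl⟩))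

/-- Primeness of the kernel: in ℝ the meet of two absolute values is one of them. -/
theorem inf_le_vanishing {v : X → ℝ} {hv : Satisfies R v} {I J : Idc (Presented R)}
    (h : (I ⊓ J).1 ≤ vanishing hv) : I.1 ≤ vanishing hv ∨ J.1 ≤ vanishing hv := by
  obtain ⟨s, hs⟩ := exists_principal I
  obtain ⟨t, ht⟩ := exists_principal J
  have hle : I.1 ⊓ J.1 ≤ vanishing hv := h
  rw [hs, ht, LIdeal.principal_inf] at hle
  rw [hs, ht, principal_le_vanishing, principal_le_vanishing]
  -- The term spells out `|s| ⊓ |t|`, with `|s|` as `s ⊔ -s`.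
  have h0 : |s.eval v| ⊓ |t.eval v| = 0 :=
    (principal_le_vanishing (t := .inf (.sup s (.neg s)) (.sup t (.neg t)))).1 hle
  rcases min_choice |s.eval v| |t.eval v| with h1 | h1
  · exact Or.inl (abs_eq_zero.1 (h1.symm.trans h0))
  · exact Or.inr (abs_eq_zero.1 (h1.symm.trans h0))

end Presented

/-! ### The cone of points of `A123` -/

/-- The valuation with given values at `a`, `a'`, `b`, `c`. -/
def valuation (x x' y z : ℝ) : Gen → ℝ
  | .a => x
  | .a' => x'
  | .b => y
  | .c => z

theorem satisfies_valuation {x x' y z : ℝ} (hx : 0 ≤ x) (hxx' : x ≤ x') (hx'x : x' ≤ x + x)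
    (hy : 0 ≤ y) (hz : 0 ≤ z) : Satisfies Rel (valuation x x' y z) := by
  rintro _ _ (_ | _ | _ | _ | _)
  exacts [hx, hxx', hx'x, hy, hz]

theorem smul_valuation (k x x' y z : ℝ) :
    k • valuation x x' y z = valuation (k * x) (k * x') (k * y) (k * z) := by
  funext g
  cases g <;> rfl

theorem continuous_valuation : Continuous fun p : ℝ × ℝ × ℝ × ℝ =>
    valuation p.1 p.2.1 p.2.2.1 p.2.2.2 := by
  refine continuous_pi fun g => ?_
  cases g <;> simp only [valuation] <;> fun_prop

/-! ### The last zero along a ray -/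

/-- Let `F` and `G` be continuous functions of two real variables, with `F` positively homogeneous,
that have disjoint supports on the first quadrant. If `F` does not vanish at `(1, 0)` and `G` does
not vanish at `(0, 1)`, then there is a largest slope, which is positive, where `F` vanishes. -/
theorem exists_last_zero {F G : ℝ → ℝ → ℝ} (hF : Continuous fun p : ℝ × ℝ => F p.1 p.2)
    (hG : Continuous fun p : ℝ × ℝ => G p.1 p.2)
    (hhom : ∀ k x y, 0 ≤ k → F (k * x) (k * y) = k * F x y)
    (hF1 : F 1 0 ≠ 0) (hG1 : G 0 1 ≠ 0)
    (hFG : ∀ x y, 0 ≤ x → 0 ≤ y → F x y = 0 ∨ G x y = 0) :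
    ∃ r, 0 < r ∧ F r 1 = 0 ∧ ∀ x, r < x → F x 1 ≠ 0 := by
  have hF' : Continuous fun x => F x 1 := hF.comp (continuous_id.prodMk continuous_const)
  have hF'' : Continuous fun y => F 1 y := hF.comp (continuous_const.prodMk continuous_id)
  have hG' : Continuous fun x => G x 1 := hG.comp (continuous_id.prodMk continuous_const)
  obtain ⟨ε, hε, hFε⟩ := Metric.eventually_nhds_iff.1 (hF''.continuousAt.eventually_ne hF1)
  obtain ⟨δ, hδ, hGδ⟩ := Metric.eventually_nhds_iff.1 (hG'.continuousAt.eventually_ne hG1)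
  -- `G` stays nonzero near `(0, 1)`, so `F` must vanish there; this gives a zero with positive
  -- slope.
  have hmem : F (δ / 2) 1 = 0 := by
    refine (hFG (δ / 2) 1 (by positivity) zero_le_one).resolve_right (hGδ ?_)
    rw [Real.dist_eq, sub_zero, abs_of_pos (by positivity)]
    linarith
  -- By homogeneity `F x 1 = x * F 1 x⁻¹`, which is nonzero for large `x` because `F` is nonzero
  -- near `(1, 0)`.
  have hbdd : ∀ x ∈ {x | F x 1 = 0}, x ≤ ε⁻¹ := by
    intro x hx
    by_contra! hlt
    have hx0 : 0 < x := (inv_pos.2 hε).trans hlt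
    have h1 : F 1 x⁻¹ ≠ 0 := by
      refine hFε ?_
      rw [Real.dist_eq, sub_zero, abs_of_pos (inv_pos.2 hx0)]
      exact inv_lt_of_inv_lt₀ hε hlt
    have h2 := hhom x 1 x⁻¹ hx0.le
    rw [mul_one, mul_inv_cancel₀ hx0.ne', show F x 1 = 0 from hx] at h2
    exact mul_ne_zero hx0.ne' h1 h2.symm
  have hclosed : IsClosed {x | F x 1 = 0} := isClosed_singleton.preimage hF'
  have hB : BddAbove {x | F x 1 = 0} := ⟨_, hbdd⟩
  refine ⟨sSup {x | F x 1 = 0}, (half_pos hδ).trans_le (le_csSup hB hmem),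
    hclosed.csSup_mem ⟨_, hmem⟩ hB, fun x hx h => ?_⟩
  exact hx.not_ge (le_csSup hB h)

end LGrp

/-! ### The contradiction from two points with equal `a'` and `c` -/

open LGrp Presented in
theorem lemma4p3 :
    ¬ ∃ c : Fin 3 → Fin 3 → LGrp.Idc LGrp.A123,
      (∀ i j, i ≠ j → c i j ∈ Set.range (LGrp.alpha i j)) ∧
      (∀ i j, (({i, j} : Finset (Fin 3)) = {0, 1} ∨ ({i, j} : Finset (Fin 3)) = {1, 2}) →
        LGrp.elt i ≤ LGrp.elt j ⊔ c i j) ∧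
      (∀ i j, (({i, j} : Finset (Fin 3)) = {0, 1} ∨ ({i, j} : Finset (Fin 3)) = {1, 2}) →
        c i j ⊓ c j i = ⊥) ∧
      c 0 1 ⊓ c 1 2 ≤ c 0 2 ∧ c 0 2 ≤ c 0 1 ⊔ c 1 2 := by
  rintro ⟨c, hrange, hcov, hdisj, hlow, hupp⟩
  choose t ht using fun i j => Presented.exists_principal (c i j)
  have hZ : ∀ {v : Gen → ℝ} (hv : Satisfies Rel v) (i j),
      (c i j).1 ≤ vanishing hv ↔ (t i j).eval v = 0 := fun hv i j => by
    rw [ht i j, principal_le_vanishing]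
  have hdep : ∀ i j g g', i ≠ j → vertexGens {i, j} = {A123.gen g, A123.gen g'} →
      ∀ {v w : Gen → ℝ}, Satisfies Rel v → Satisfies Rel w → v g = w g → v g' = w g' →
      (t i j).eval v = 0 → (t i j).eval w = 0 := by
    intro i j g g' hij hgens v w hv hw hg hg' h
    obtain ⟨J, hJ⟩ := hrange i j hij
    rw [← hZ hv, ← hJ] at h
    rw [← hZ hw, ← hJ]
    refine map_incl_le_vanishing hv hw ?_ J h
    rw [hgens]
    rintro x (rfl | rfl)
    exacts [hg, hg']
  -- Where `a_j` vanishes and `a_i` does not, `a_i ≤ a_j ∨ c_ij` forces `c_ij` to be nonzero.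
  have hcov' : ∀ {v : Gen → ℝ} (_ : Satisfies Rel v) (i j),
      (({i, j} : Finset (Fin 3)) = {0, 1} ∨ ({i, j} : Finset (Fin 3)) = {1, 2}) →
      ∀ g g', elt i = Idc.gen (A123.gen g) → elt j = Idc.gen (A123.gen g') →
      v g' = 0 → v g ≠ 0 → (t i j).eval v ≠ 0 := by
    intro v hv i j hij g g' hg hg' h0 h1 h
    refine h1 ?_
    have hle : (elt i).1 ≤ (elt j).1 ⊔ (c i j).1 := hcov i j hij
    rw [hg, hg'] at hle
    have hgen : ∀ g, (Idc.gen (A123.gen g)).1 ≤ vanishing hv ↔ v g = 0 := fun g => by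
      have h := principal_le_vanishing (hv := hv) (t := .var g)
      rw [← LIdeal.span_singleton] at h
      exact h
    exact (hgen g).1 (hle.trans (sup_le ((hgen g').2 h0) ((hZ hv i j).2 h)))
  have hdisj' : ∀ {v : Gen → ℝ} (_ : Satisfies Rel v) (i j),
      (({i, j} : Finset (Fin 3)) = {0, 1} ∨ ({i, j} : Finset (Fin 3)) = {1, 2}) →
      (t i j).eval v = 0 ∨ (t j i).eval v = 0 := by
    intro v hv i j hij
    rw [← hZ hv, ← hZ hv]
    refine inf_le_vanishing ?_
    rw [hdisj i j hij]
    exact (bot_le : (⊥ : LIdeal A123) ≤ _)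
  have hcont : ∀ i j, Continuous fun p : ℝ × ℝ × ℝ × ℝ =>
      (t i j).eval (valuation p.1 p.2.1 p.2.2.1 p.2.2.2) := fun i j =>
    (t i j).continuous_eval.comp continuous_valuation
  -- The values `a' = x` and `c = 0` merely satisfy the relations; by `hdep` they do not affect
  -- whether `c₁₂` vanishes.
  obtain ⟨r, hr, hr0, hr1⟩ := exists_last_zero
    (F := fun x y => (t 0 1).eval (valuation x x y 0))
    (G := fun x y => (t 1 0).eval (valuation x x y 0))
    ((hcont 0 1).comp (g := fun p : ℝ × ℝ × ℝ × ℝ => _)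
      (f := fun p : ℝ × ℝ => (p.1, p.1, p.2, 0)) (by fun_prop))
    ((hcont 1 0).comp (g := fun p : ℝ × ℝ × ℝ × ℝ => _)
      (f := fun p : ℝ × ℝ => (p.1, p.1, p.2, 0)) (by fun_prop))
    (fun k x y hk => by
      have h := (t 0 1).eval_smul hk (valuation x x y 0)
      rwa [smul_valuation, mul_zero] at h)
    (hcov' (satisfies_valuation zero_le_one le_rfl (by norm_num) le_rfl le_rfl) 0 1 (by decide)
      .a .b rfl rfl rfl one_ne_zero)
    (hcov' (satisfies_valuation le_rfl le_rfl (by norm_num) zero_le_one le_rfl) 1 0 (by decide)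
      .b .a rfl rfl rfl one_ne_zero)
    (fun x y hx hy => hdisj' (satisfies_valuation hx le_rfl (by linarith) hy le_rfl) 0 1
      (by decide))
  -- Likewise `a = a' = 0` is an arbitrary admissible choice for `c₂₃`.
  obtain ⟨q, hq, hq0, hq1⟩ := exists_last_zero
    (F := fun y z => (t 1 2).eval (valuation 0 0 y z))
    (G := fun y z => (t 2 1).eval (valuation 0 0 y z))
    ((hcont 1 2).comp (g := fun p : ℝ × ℝ × ℝ × ℝ => _)
      (f := fun p : ℝ × ℝ => (0, 0, p.1, p.2)) (by fun_prop))
    ((hcont 2 1).comp (g := fun p : ℝ × ℝ × ℝ × ℝ => _)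
      (f := fun p : ℝ × ℝ => (0, 0, p.1, p.2)) (by fun_prop))
    (fun k x y hk => by
      have h := (t 1 2).eval_smul hk (valuation 0 0 x y)
      rwa [smul_valuation, mul_zero] at h)
    (hcov' (satisfies_valuation le_rfl le_rfl (by norm_num) zero_le_one le_rfl) 1 2 (by decide)
      .b .c rfl rfl rfl one_ne_zero)
    (hcov' (satisfies_valuation le_rfl le_rfl (by norm_num) le_rfl zero_le_one) 2 1 (by decide)
      .c .b rfl rfl rfl one_ne_zero)
    (fun x y hx hy => hdisj' (satisfies_valuation le_rfl le_rfl (by norm_num) hx hy) 1 2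
      (by decide))
  have hgens₁ : vertexGens {0, 1} = {A123.gen .a, A123.gen .b} := if_pos rfl
  have hgens₂ : vertexGens {0, 2} = {A123.gen .a', A123.gen .c} :=
    (if_neg (by decide)).trans (if_pos rfl)
  have hgens₃ : vertexGens {1, 2} = {A123.gen .b, A123.gen .c} :=
    (if_neg (by decide)).trans ((if_neg (by decide)).trans (if_pos rfl))
  -- Both ratios will be enlarged by the factor `6 / 5`, so `a` grows by `36 / 25 = (6 / 5)²`. Any
  -- factor above 1 with square at most 2 would do: the common value of `a'` must be at most twice
  -- the smaller `a`.
  have hrq : 0 < r * q := mul_pos hr hq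
  -- The point with coordinate ratios `r`, `q`, where `c₁₂`, `c₂₃`, hence also `c₁₃`, vanish.
  have hv : Satisfies Rel (valuation (r * q) (36 / 25 * (r * q)) q 1) :=
    satisfies_valuation hrq.le (by linarith) (by linarith) hq.le zero_le_one
  -- The point with slightly larger ratios, where `c₁₂` and `c₂₃` are nonzero.
  have hw : Satisfies Rel (valuation (36 / 25 * (r * q)) (36 / 25 * (r * q)) (6 / 5 * q) 1) :=
    satisfies_valuation (by positivity) le_rfl (by linarith) (by positivity) zero_le_one
  have hv₁ : (t 0 1).eval (valuation (r * q) (36 / 25 * (r * q)) q 1) = 0 := by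
    -- Scaling the zero at slope `r` by `q` gives `a = r * q`, `b = q`; then `a'` and `c` are
    -- changed freely.
    have h := (t 0 1).eval_smul hq.le (valuation r r 1 0)
    rw [smul_valuation, hr0, mul_zero, mul_one, mul_comm q r] at h
    exact hdep 0 1 .a .b (by decide) hgens₁
      (satisfies_valuation hrq.le le_rfl (by linarith) hq.le le_rfl) hv rfl rfl h
  have hv₃ : (t 1 2).eval (valuation (r * q) (36 / 25 * (r * q)) q 1) = 0 :=
    hdep 1 2 .b .c (by decide) hgens₃
      (satisfies_valuation le_rfl le_rfl (by norm_num) hq.le zero_le_one) hv rfl rfl hq0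
  have hv₂ : (t 0 2).eval (valuation (r * q) (36 / 25 * (r * q)) q 1) = 0 := by
    have hle : (c 0 2).1 ≤ (c 0 1).1 ⊔ (c 1 2).1 := hupp
    exact (hZ hv 0 2).1 (hle.trans (sup_le ((hZ hv 0 1).2 hv₁) ((hZ hv 1 2).2 hv₃)))
  -- The two points agree in `a'` and `c`, so the vanishing of `c₁₃` is transferred from one to the
  -- other.
  have hw₂ := hdep 0 2 .a' .c (by decide) hgens₂ hv hw rfl rfl hv₂
  have hle : (c 0 1 ⊓ c 1 2).1 ≤ (c 0 2).1 := hlow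
  rcases inf_le_vanishing (hle.trans ((hZ hw 0 2).2 hw₂)) with h | h
  · refine hr1 (6 / 5 * r) (by linarith) ?_
    have hk : 0 < 6 / 5 * q := by positivity
    have h' := hdep 0 1 .a .b (by decide) hgens₁ hw
      (satisfies_valuation (x' := 36 / 25 * (r * q)) (z := 0) (by positivity) le_rfl (by linarith)
        hk.le le_rfl) rfl rfl ((hZ hw 0 1).1 h)
    -- Dividing by `b = 6 / 5 * q` normalizes the point to slope `6 / 5 * r`, beyond the last zero
    -- `r`.
    have h'' := (t 0 1).eval_smul hk.le (valuation (6 / 5 * r) (6 / 5 * r) 1 0)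
    rw [smul_valuation, mul_one, mul_zero,
      show 6 / 5 * q * (6 / 5 * r) = 36 / 25 * (r * q) by ring, h'] at h''
    exact (mul_eq_zero.1 h''.symm).resolve_left hk.ne'
  · exact hq1 (6 / 5 * q) (by linarith) (hdep 1 2 .b .c (by decide) hgens₃ hw
      (satisfies_valuation le_rfl le_rfl (by norm_num) (by positivity) zero_le_one) rfl rfl
      ((hZ hw 1 2).1 h))
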